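/- Let $m$ be a positive integer and let $\rho=(\rho_1,\dots,\rho_m)\in(0,1]^m$. Write $\Delta(0;\rho)=\{z\in\mathbb{C}^m : |z_i|<\rho_i \text{ for } 1\le i\le m\}$, and let $\overline{\mathbb{Q}}\subset\mathbb{C}$ be the field of algebraic numbers. A power series $f(z)=\sum_{k\in\mathbb{N}_0^m} f_k z_1^{k_1}\cdots z_m^{k_m}$ is said to have polyradius of convergence $\rho$ if its domain of convergence, that is, the interior of the set of points $z\in\mathbb{C}^m$ at which it converges absolutely, is exactly $\Delta(0;\rho)$. Such an $f$ is called transcendental if the only polynomial $P\in\mathbb{C}[X_1,\dots,X_{m+1}]$ with $P(z_1,\dots,z_m,f(z))=0$ for all $z\in\Delta(0;\rho)$ is the zero polynomial, and its exceptional set is $$S_f=\{\alpha\in\overline{\mathbb{Q}}^m\cap\Delta(0;\rho) : f(\alpha)\in\overline{\mathbb{Q}}\}.$$ Let $S\subseteq\overline{\mathbb{Q}}^m\cap\Delta(0;\rho)$ be a set that contains $(0,\dots,0)$ and is closed under coordinatewise complex conjugation $(z_1,\dots,z_m)\mapsto(\overline{z_1},\dots,\overline{z_m})$. Then there are uncountably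 many transcendental power series $f$ in $m$ variables with integer coefficients and polyradius of convergence $\rho$ such that $S_f=S$. -/

import Mathlib

namespace Exceptional

/-- The open polydisc `Δ(w; ρ)` in `ℂᵐ`. -/
def polydisc {m : ℕ} (w : Fin m → ℂ) (ρ : Fin m → ℝ) : Set (Fin m → ℂ) :=
  {z | ∀ i, ‖z i - w i‖ < ρ i}

/-- The term of multi-index `k` of the power series `f` at the point `z`. -/
noncomputable def term {m : ℕ} (f : MvPowerSeries (Fin m) ℂ) (z : Fin m → ℂ)
    (k : Fin m →₀ ℕ) : ℂ :=
  MvPowerSeries.coeff k f * ∏ i, z i ^ k i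

/-- The domain of convergence of a power series: the interior of the set of points
at which it converges absolutely. -/
def convergenceDomain {m : ℕ} (f : MvPowerSeries (Fin m) ℂ) : Set (Fin m → ℂ) :=
  interior {z | Summable fun k => ‖term f z k‖}

/-- `f` has polyradius of convergence `ρ`: its domain of convergence is exactly `Δ(0; ρ)`. -/
def HasPolyradius {m : ℕ} (f : MvPowerSeries (Fin m) ℂ) (ρ : Fin m → ℝ) : Prop :=
  convergenceDomain f = polydisc 0 ρ

/-- The function that a power series defines (meaningful where the series converges). -/
noncomputable def toFun {m : ℕ} (f : MvPowerSeries (Fin m) ℂ) (z : Fin m → ℂ) : ℂ :=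
  ∑' k, term f z k

/-- `F` is transcendental on `Ω`: the only complex polynomial `P` in `m + 1` variables with
`P(z₁, …, zₘ, F(z)) = 0` on all of `Ω` is the zero polynomial. -/
def IsTranscendentalOn {m : ℕ} (Ω : Set (Fin m → ℂ)) (F : (Fin m → ℂ) → ℂ) : Prop :=
  ∀ P : MvPolynomial (Fin (m + 1)) ℂ,
    (∀ z ∈ Ω, MvPolynomial.eval (Fin.snoc z (F z) : Fin (m + 1) → ℂ) P = 0) → P = 0

/-- The points of `Ω` with algebraic coordinates. -/
def algebraicPoints {m : ℕ} (Ω : Set (Fin m → ℂ)) : Set (Fin m → ℂ) :=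
  {α | α ∈ Ω ∧ ∀ i, IsAlgebraic ℚ (α i)}

/-- The exceptional set of `F : Ω → ℂ`: the algebraic points of `Ω` at which `F` takes an
algebraic value. -/
def exceptionalSet {m : ℕ} (Ω : Set (Fin m → ℂ)) (F : (Fin m → ℂ) → ℂ) : Set (Fin m → ℂ) :=
  {α | α ∈ algebraicPoints Ω ∧ IsAlgebraic ℚ (F α)}

/-- A power series with integer coefficients, regarded as a complex power series. -/
noncomputable def toComplex {m : ℕ} (f : MvPowerSeries (Fin m) ℤ) : MvPowerSeries (Fin m) ℂ :=
  MvPowerSeries.map (Int.castRingHom ℂ) f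

end Exceptional

/-! The series is built as `f₀ + ∑ qₙ`. The integral series `f₀` has coefficients of size about `∏
(kᵢ + 1) ρᵢ⁻ᵏⁱ`, which fixes the polyradius. The corrections `qₙ` are integral with coefficients at
most `2⁻ⁿ⁻¹ |k|`, too small to affect it. The nonzero algebraic points of the polydisc are
enumerated as `αₙ`, up to conjugation. The correction `qₙ` vanishes at `α₀, …, αₙ₋₁` and makes the
value at `αₙ` algebraic exactly when `αₙ ∈ S`. Later corrections leave that value unchanged.
Conjugate points follow because the coefficients are real, and the value at `0` is an integer.

A correction (`exists_integral_correction`) has the form `zⱼᴺ (Q R + p h)`. Here `Q`, `R`, `p` are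
real polynomials: `Q` vanishes at the earlier points but not at the new one, `R` tunes the new
value, and `p` vanishes at all these points and has constant term `1`. The series `h`, with
coefficients in `[0, 1)`, rounds `Q R + p h` to integer coefficients without changing any of these
values. The factor `zⱼᴺ` pushes the bounded coefficients to high degree, where the bound `ε |k|` is
weak.

Each value can also be kept away from one prescribed number, so `f` can avoid any given sequence of
series (`exists_exceptionalSet_eq`). Only countably many integral series are algebraic over `ℚ[z]`,
and a convergent integral series that is not is a transcendental function. If the set in question
were countable, avoiding it together with those algebraic series would give a contradiction. -/

namespace Exceptional

open Finset Filter Topology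

variable {m : ℕ}

/-! ### Evaluation of absolutely convergent power series -/

/-- Absolute convergence of the power series `F` at the point `z`. -/
def AbsConv (F : MvPowerSeries (Fin m) ℂ) (z : Fin m → ℂ) : Prop :=
  Summable fun k => ‖term F z k‖

theorem term_add (F G : MvPowerSeries (Fin m) ℂ) (z : Fin m → ℂ) :
    term (F + G) z = term F z + term G z := by
  ext k
  simp [term, add_mul]

theorem term_mul (F G : MvPowerSeries (Fin m) ℂ) (z : Fin m → ℂ) (k : Fin m →₀ ℕ) :
    term (F * G) z k = ∑ x ∈ antidiagonal k, term F z x.1 * term G z x.2 := by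
  rw [term, MvPowerSeries.coeff_mul, sum_mul]
  refine sum_congr rfl fun x hx => ?_
  rw [← mem_antidiagonal.1 hx]
  simp only [term, Finsupp.add_apply, pow_add, prod_mul_distrib]
  ring

theorem AbsConv.summable {F : MvPowerSeries (Fin m) ℂ} {z : Fin m → ℂ} (h : AbsConv F z) :
    Summable (term F z) :=
  Summable.of_norm h

theorem AbsConv.add {F G : MvPowerSeries (Fin m) ℂ} {z : Fin m → ℂ} (hF : AbsConv F z)
    (hG : AbsConv G z) : AbsConv (F + G) z := by
  refine Summable.of_nonneg_of_le (fun _ => norm_nonneg _) (fun k => ?_) (Summable.add hF hG)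
  rw [term_add]
  exact norm_add_le _ _

theorem toFun_add {F G : MvPowerSeries (Fin m) ℂ} {z : Fin m → ℂ} (hF : AbsConv F z)
    (hG : AbsConv G z) : toFun (F + G) z = toFun F z + toFun G z := by
  rw [toFun, term_add]
  exact hF.summable.tsum_add hG.summable

theorem AbsConv.mul {F G : MvPowerSeries (Fin m) ℂ} {z : Fin m → ℂ} (hF : AbsConv F z)
    (hG : AbsConv G z) : AbsConv (F * G) z := by
  have h := summable_sum_mul_antidiagonal_of_summable_mul
    (Summable.mul_of_nonneg hF hG (fun _ => norm_nonneg _) fun _ => norm_nonneg _)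
  refine Summable.of_nonneg_of_le (fun _ => norm_nonneg _) (fun k => ?_) h
  rw [term_mul]
  exact (norm_sum_le _ _).trans (sum_le_sum fun x _ => (norm_mul _ _).le)

theorem toFun_mul {F G : MvPowerSeries (Fin m) ℂ} {z : Fin m → ℂ} (hF : AbsConv F z)
    (hG : AbsConv G z) : toFun (F * G) z = toFun F z * toFun G z := by
  simp only [toFun]
  rw [hF.summable.tsum_mul_tsum_eq_tsum_sum_antidiagonal hG.summable
    (summable_mul_of_summable_norm hF hG)]
  exact tsum_congr fun k => term_mul F G z k

theorem hasSum_term_coe (P : MvPolynomial (Fin m) ℂ) (z : Fin m → ℂ) :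
    HasSum (term (P : MvPowerSeries (Fin m) ℂ) z) (MvPolynomial.eval z P) := by
  rw [MvPolynomial.eval_eq']
  refine hasSum_sum_of_ne_finset_zero fun k hk => ?_
  rw [term, MvPolynomial.coeff_coe, MvPolynomial.notMem_support_iff.1 hk, zero_mul]

theorem absConv_coe (P : MvPolynomial (Fin m) ℂ) (z : Fin m → ℂ) :
    AbsConv (P : MvPowerSeries (Fin m) ℂ) z :=
  (hasSum_term_coe P z).summable.norm

theorem toFun_coe (P : MvPolynomial (Fin m) ℂ) (z : Fin m → ℂ) :
    toFun (P : MvPowerSeries (Fin m) ℂ) z = MvPolynomial.eval z P :=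
  (hasSum_term_coe P z).tsum_eq

/-- Evaluation at `z` respects sums and products of series absolutely convergent at `z`, so it
commutes with polynomial substitution. This turns a functional relation into a formal one. -/
theorem absConv_and_toFun_aeval {F : MvPowerSeries (Fin m) ℂ} {z : Fin m → ℂ}
    (hF : AbsConv F z) (P : MvPolynomial (Fin (m + 1)) ℂ) :
    AbsConv (MvPolynomial.aeval (Fin.snoc (fun i => MvPowerSeries.X i) F :
      Fin (m + 1) → MvPowerSeries (Fin m) ℂ) P) z ∧
    toFun (MvPolynomial.aeval (Fin.snoc (fun i => MvPowerSeries.X i) F :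
      Fin (m + 1) → MvPowerSeries (Fin m) ℂ) P) z =
      MvPolynomial.eval (Fin.snoc z (toFun F z) : Fin (m + 1) → ℂ) P := by
  induction P using MvPolynomial.induction_on with
  | C a =>
    have h : (MvPolynomial.aeval (Fin.snoc (fun i => MvPowerSeries.X i) F :
        Fin (m + 1) → MvPowerSeries (Fin m) ℂ) (MvPolynomial.C a)) =
        ((MvPolynomial.C a : MvPolynomial (Fin m) ℂ) : MvPowerSeries (Fin m) ℂ) := by
      rw [MvPolynomial.aeval_C, MvPolynomial.coe_C]
      rfl
    rw [h, toFun_coe]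
    exact ⟨absConv_coe _ _, by simp⟩
  | add p q hp hq =>
    rw [map_add, map_add, toFun_add hp.1 hq.1, hp.2, hq.2]
    exact ⟨hp.1.add hq.1, rfl⟩
  | mul_X p i hp =>
    have hX : AbsConv ((Fin.snoc (fun i => MvPowerSeries.X i) F :
        Fin (m + 1) → MvPowerSeries (Fin m) ℂ) i) z ∧
        toFun ((Fin.snoc (fun i => MvPowerSeries.X i) F :
        Fin (m + 1) → MvPowerSeries (Fin m) ℂ) i) z =
          (Fin.snoc z (toFun F z) : Fin (m + 1) → ℂ) i := by
      refine Fin.lastCases ?_ (fun j => ?_) i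
      · simpa using hF
      · simp only [Fin.snoc_castSucc, ← MvPolynomial.coe_X, toFun_coe, MvPolynomial.eval_X]
        exact ⟨absConv_coe _ _, trivial⟩
    rw [map_mul, map_mul, MvPolynomial.aeval_X, toFun_mul hp.1 hX.1, hp.2, hX.2,
      MvPolynomial.eval_X]
    exact ⟨hp.1.mul hX.1, rfl⟩

/-! ### Dominating series on a polydisc -/

theorem summable_prod_apply {a : Fin m → ℕ → ℝ} (h0 : ∀ i n, 0 ≤ a i n)
    (ha : ∀ i, Summable (a i)) : Summable fun k : Fin m →₀ ℕ => ∏ i, a i (k i) := by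
  have h : Summable fun k : Fin m → ℕ => ∏ i, a i (k i) := by
    refine summable_of_sum_le (c := ∏ i, ∑' n, a i n)
      (fun k => prod_nonneg fun i _ => h0 i _) fun s => ?_
    let t : Fin m → Finset ℕ := fun i => s.image fun k => k i
    calc ∑ k ∈ s, ∏ i, a i (k i) ≤ ∑ k ∈ Fintype.piFinset t, ∏ i, a i (k i) := by
          refine sum_le_sum_of_subset_of_nonneg (fun k hk => ?_)
            fun k _ _ => prod_nonneg fun i _ => h0 i _
          exact Fintype.mem_piFinset.2 fun i => mem_image_of_mem _ hk
      _ = ∏ i, ∑ n ∈ t i, a i n := (prod_univ_sum t a).symm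
      _ ≤ _ := prod_le_prod (fun i _ => sum_nonneg fun n _ => h0 i n)
          fun i _ => (ha i).sum_le_tsum _ fun n _ => h0 i n
  exact h.comp_injective DFunLike.coe_injective

theorem summable_prod_succ_mul_pow {r : Fin m → ℝ} (h0 : ∀ i, 0 ≤ r i) (h1 : ∀ i, r i < 1) :
    Summable fun k : Fin m →₀ ℕ => ∏ i, ((k i + 1 : ℝ) * r i ^ k i) := by
  refine summable_prod_apply (a := fun i n => (n + 1 : ℝ) * r i ^ n)
    (fun i n => mul_nonneg (by positivity) (pow_nonneg (h0 i) _)) fun i => ?_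
  have h2 : ‖r i‖ < 1 := by rw [Real.norm_of_nonneg (h0 i)]; exact h1 i
  have := (summable_pow_mul_geometric_of_norm_lt_one 1 h2).add
    (summable_geometric_of_norm_lt_one h2)
  refine this.congr fun n => ?_
  ring

theorem degree_le_prod_succ (k : Fin m →₀ ℕ) : (k.degree : ℝ) ≤ ∏ i, (k i + 1 : ℝ) := by
  have : ∀ s : Finset (Fin m), (∑ i ∈ s, (k i : ℝ)) + 1 ≤ ∏ i ∈ s, (k i + 1 : ℝ) := by
    intro s
    induction s using Finset.induction_on with
    | empty => simp
    | insert a s ha ih =>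
      rw [sum_insert ha, prod_insert ha]
      have h1 : 0 ≤ ∑ i ∈ s, (k i : ℝ) := sum_nonneg fun i _ => by positivity
      have h2 : (0 : ℝ) ≤ k a := by positivity
      nlinarith
  have h := this univ
  rw [Finsupp.degree_eq_sum]
  push_cast
  linarith

/-! ### Identity theorem -/

theorem eq_zero_of_hasSum_pow {a : ℕ → ℂ}
    (h : ∀ t : ℂ, ‖t‖ < 1 → HasSum (fun d => t ^ d * a d) 0) (d : ℕ) : a d = 0 := by
  have h1 : HasFPowerSeriesAt (0 : ℂ → ℂ) (FormalMultilinearSeries.ofScalars ℂ a) 0 := by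
    rw [hasFPowerSeriesAt_iff]
    filter_upwards [Metric.ball_mem_nhds (0 : ℂ) one_pos] with t ht
    simpa [FormalMultilinearSeries.coeff_ofScalars] using h t (by simpa using ht)
  exact congrFun ((FormalMultilinearSeries.ofScalars_series_eq_zero ℂ).1 h1.eq_zero) d

/-- The identity theorem for power series on a polydisc. -/
theorem eq_zero_of_toFun_eq_zero {ρ : Fin m → ℝ} (hρ : ∀ i, 0 < ρ i)
    {F : MvPowerSeries (Fin m) ℂ} (hF : ∀ z ∈ polydisc 0 ρ, AbsConv F z)
    (h0 : ∀ z ∈ polydisc 0 ρ, toFun F z = 0) : F = 0 := by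
  classical
  let H : ℕ → MvPolynomial (Fin m) ℂ := fun d =>
    ∑ k ∈ finsuppAntidiag univ d, MvPolynomial.monomial k (MvPowerSeries.coeff k F)
  -- On the line `t ↦ t c` the series becomes a one-variable power series whose `d`-th coefficient
  -- is the homogeneous part `H d` at `c`. So `H d` vanishes on a product of infinite sets.
  have key : ∀ d, H d = 0 := by
    intro d
    refine MvPolynomial.funext_set (fun i => Metric.ball (0 : ℂ) (ρ i)) (fun i => ?_)
      fun c hc => ?_
    · exact infinite_of_mem_nhds 0 (Metric.ball_mem_nhds _ (hρ i))
    rw [map_zero]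
    refine eq_zero_of_hasSum_pow (a := fun d => MvPolynomial.eval c (H d)) (fun t ht => ?_) d
    have hz : (fun i => t * c i) ∈ polydisc 0 ρ := by
      intro i
      have h2 : ‖c i‖ < ρ i := by simpa using hc i trivial
      simp only [Pi.zero_apply, sub_zero, norm_mul]
      nlinarith [norm_nonneg t, norm_nonneg (c i)]
    have hs : HasSum (term F fun i => t * c i) 0 := by
      have := (hF _ hz).summable.hasSum
      rwa [show ∑' k, term F (fun i => t * c i) k = 0 from h0 _ hz] at this
    refine Eq.mp (congrArg (fun a => HasSum a (0 : ℂ)) (funext fun e => Eq.symm ?_))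
      (hs.tsum_fiberwise fun k : Fin m →₀ ℕ => k.degree)
    have hset : ((fun k : Fin m →₀ ℕ => k.degree) ⁻¹' {e}) =
        ((finsuppAntidiag univ e : Finset (Fin m →₀ ℕ)) : Set (Fin m →₀ ℕ)) := by
      ext k
      simp [mem_finsuppAntidiag, Finsupp.degree_eq_sum]
    rw [hset, Finset.tsum_subtype', map_sum, mul_sum]
    refine sum_congr rfl fun k hk => ?_
    have hk' : ∑ i, k i = e := (mem_finsuppAntidiag.1 hk).1
    rw [MvPolynomial.eval_monomial, Finsupp.prod_fintype _ _ fun i => pow_zero _, term,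
      ← hk', ← prod_pow_eq_pow_sum]
    simp only [mul_pow, prod_mul_distrib]
    ring
  ext k
  have := congrArg (MvPolynomial.coeff k) (key k.degree)
  rw [MvPolynomial.coeff_sum] at this
  simp only [MvPolynomial.coeff_monomial, sum_ite_eq', MvPolynomial.coeff_zero] at this
  rw [if_pos (by simp [mem_finsuppAntidiag, Finsupp.degree_eq_sum])] at this
  simpa using this

/-! ### Formal and functional transcendence -/

theorem aeval_optionEquivLeft_rename (F : MvPowerSeries (Fin m) ℚ)
    (P : MvPolynomial (Fin (m + 1)) ℚ) :
    Polynomial.aeval F (MvPolynomial.optionEquivLeft ℚ (Fin m)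
      (MvPolynomial.rename finSuccEquivLast P)) =
    MvPolynomial.aeval (Fin.snoc (fun i => MvPowerSeries.X i) F :
      Fin (m + 1) → MvPowerSeries (Fin m) ℚ) P := by
  induction P using MvPolynomial.induction_on with
  | C a =>
    simp [MvPowerSeries.algebraMap_apply', MvPowerSeries.algebraMap_apply]
  | add p q hp hq => simp only [map_add, hp, hq]
  | mul_X p i hp =>
    rw [map_mul, map_mul, map_mul, map_mul, hp]
    congr 1
    refine Fin.lastCases ?_ (fun j => ?_) i
    · simp
    · simp [MvPowerSeries.algebraMap_apply']

/-- The ring `ℚ[z]` is countable, and a nonzero polynomial over it has finitely many roots in the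
domain of power series. -/
theorem countable_isAlgebraic_map :
    {f : MvPowerSeries (Fin m) ℤ | IsAlgebraic (MvPolynomial (Fin m) ℚ)
      (MvPowerSeries.map (Int.castRingHom ℚ) f)}.Countable := by
  have hinj : Function.Injective (algebraMap (MvPolynomial (Fin m) ℚ) (MvPowerSeries (Fin m) ℚ)) := by
    intro p q h
    simpa [MvPowerSeries.algebraMap_apply'] using h
  have : Module.IsTorsionFree (MvPolynomial (Fin m) ℚ) (MvPowerSeries (Fin m) ℚ) := by
    have : FaithfulSMul (MvPolynomial (Fin m) ℚ) (MvPowerSeries (Fin m) ℚ) :=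
      (faithfulSMul_iff_algebraMap_injective _ _).2 hinj
    infer_instance
  have : Countable (MvPolynomial (Fin m) ℚ) := Cardinal.mk_le_aleph0_iff.1 <|
    (MvPolynomial.cardinalMk_le_max (σ := Fin m) (R := ℚ)).trans (by simp)
  have : IsDomain (MvPowerSeries (Fin m) ℚ) := NoZeroDivisors.to_isDomain _
  refine (Algebraic.countable (MvPolynomial (Fin m) ℚ) (MvPowerSeries (Fin m) ℚ)).preimage_of_injOn
    (f := MvPowerSeries.map (Int.castRingHom ℚ)) ?_
  intro f _ g _ hfg
  ext k
  simpa using congrArg (MvPowerSeries.coeff k) hfg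

/-- A convergent integral power series that is formally transcendental over `ℚ[z]` defines a
transcendental function. -/
theorem isTranscendentalOn_of_not_isAlgebraic {ρ : Fin m → ℝ} (hρ : ∀ i, 0 < ρ i)
    {f : MvPowerSeries (Fin m) ℤ} (hf : ∀ z ∈ polydisc 0 ρ, AbsConv (toComplex f) z)
    (h : ¬ IsAlgebraic (MvPolynomial (Fin m) ℚ) (MvPowerSeries.map (Int.castRingHom ℚ) f)) :
    IsTranscendentalOn (polydisc 0 ρ) (toFun (toComplex f)) := by
  intro P hP
  by_contra hP0
  obtain ⟨s, hs⟩ := MvPolynomial.ne_zero_iff.1 hP0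
  -- Since `f` has rational coefficients, applying a `ℚ`-linear functional to the coefficients of
  -- `P` gives a rational relation. It is nontrivial because `φ` does not kill the coefficient at
  -- `s`.
  obtain ⟨φ, hφ⟩ : ∃ φ : Module.Dual ℚ ℂ, φ (P.coeff s) ≠ 0 := by
    by_contra! hφ
    exact hs ((Module.forall_dual_apply_eq_zero_iff ℚ _).1 hφ)
  have hzero : MvPolynomial.aeval (Fin.snoc (fun i => MvPowerSeries.X i) (toComplex f) :
      Fin (m + 1) → MvPowerSeries (Fin m) ℂ) P = 0 :=
    eq_zero_of_toFun_eq_zero hρ (fun z hz => (absConv_and_toFun_aeval (hf z hz) P).1)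
      fun z hz => by rw [(absConv_and_toFun_aeval (hf z hz) P).2, hP z hz]
  set fQ := MvPowerSeries.map (Int.castRingHom ℚ) f with hfQ
  let x : Fin (m + 1) → MvPowerSeries (Fin m) ℚ := Fin.snoc (fun i => MvPowerSeries.X i) fQ
  have hx : ∀ i, (Fin.snoc (fun i => MvPowerSeries.X i) (toComplex f) :
      Fin (m + 1) → MvPowerSeries (Fin m) ℂ) i = MvPowerSeries.map (algebraMap ℚ ℂ) (x i) := by
    intro i
    refine Fin.lastCases ?_ (fun j => ?_) i
    · simp only [x, Fin.snoc_last, hfQ]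
      ext k
      simp [toComplex]
    · simp [x]
  let P' : MvPolynomial (Fin (m + 1)) ℚ :=
    ∑ d ∈ P.support, MvPolynomial.monomial d (φ (P.coeff d))
  have hP' : P' ≠ 0 := by
    intro h0
    have := congrArg (MvPolynomial.coeff s) h0
    rw [MvPolynomial.coeff_sum] at this
    simp only [MvPolynomial.coeff_monomial, sum_ite_eq', MvPolynomial.mem_support_iff,
      MvPolynomial.coeff_zero, if_pos hs] at this
    exact hφ this
  have hroot : MvPolynomial.aeval x P' = 0 := by
    ext k
    have hk := congrArg (fun G => φ (MvPowerSeries.coeff k G)) hzero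
    simp only [MvPolynomial.aeval_def, MvPolynomial.eval₂_eq', hx, ← map_pow, ← map_prod,
      map_sum, MvPowerSeries.algebraMap_apply, MvPowerSeries.coeff_C_mul,
      MvPowerSeries.coeff_map, map_zero] at hk
    simp only [P', map_sum, MvPolynomial.aeval_monomial, MvPowerSeries.algebraMap_apply,
      MvPowerSeries.coeff_C_mul, map_zero]
    rw [← hk]
    refine sum_congr rfl fun d _ => ?_
    rw [Finsupp.prod_fintype _ _ fun i => pow_zero _]
    have : ∀ (c : ℂ) (r : ℚ), φ (c * algebraMap ℚ ℂ r) = φ c * r := by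
      intro c r
      rw [mul_comm, ← Algebra.smul_def, map_smul, smul_eq_mul, mul_comm]
    rw [Algebra.algebraMap_self_apply, Algebra.algebraMap_self_apply, this]
  refine h ⟨MvPolynomial.optionEquivLeft ℚ (Fin m) (MvPolynomial.rename finSuccEquivLast P'),
    ?_, ?_⟩
  · rw [Ne, EmbeddingLike.map_eq_zero_iff]
    exact fun h0 => hP' (MvPolynomial.rename_injective _ finSuccEquivLast.injective
      (by rw [h0, map_zero]))
  · rw [aeval_optionEquivLeft_rename]
    exact hroot

/-! ### Convergence from coefficient bounds -/

theorem absConv_of_norm_coeff_le {ρ : Fin m → ℝ} (hρ : ∀ i, 0 < ρ i)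
    {F : MvPowerSeries (Fin m) ℂ} {C : ℝ}
    (hF : ∀ k, ‖MvPowerSeries.coeff k F‖ ≤ C * ∏ i, ((k i + 1 : ℝ) * (ρ i)⁻¹ ^ k i))
    {z : Fin m → ℂ} (hz : z ∈ polydisc 0 ρ) : AbsConv F z := by
  have hs := (summable_prod_succ_mul_pow (r := fun i => ‖z i‖ / ρ i)
    (fun i => div_nonneg (norm_nonneg _) (hρ i).le)
    fun i => (div_lt_one (hρ i)).2 (by simpa using hz i)).mul_left C
  refine Summable.of_nonneg_of_le (fun _ => norm_nonneg _) (fun k => ?_) hs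
  rw [term, norm_mul, norm_prod]
  refine (mul_le_mul_of_nonneg_right (hF k) (prod_nonneg fun i _ => norm_nonneg _)).trans_eq ?_
  rw [mul_assoc, ← prod_mul_distrib]
  congr 1
  refine prod_congr rfl fun i _ => ?_
  rw [norm_pow, div_eq_mul_inv, mul_pow]
  ring

theorem one_le_prod_succ_mul {ρ : Fin m → ℝ} (hρ : ∀ i, 0 < ρ i ∧ ρ i ≤ 1) (k : Fin m →₀ ℕ) :
    1 ≤ ∏ i, ((k i + 1 : ℝ) * (ρ i)⁻¹ ^ k i) := by
  refine (prod_const_one (ι := Fin m) (s := univ)).symm.le.trans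
    (prod_le_prod (fun _ _ => zero_le_one) fun i _ => ?_)
  have h1 : (1 : ℝ) ≤ (ρ i)⁻¹ ^ k i := one_le_pow₀ ((one_le_inv₀ (hρ i).1).2 (hρ i).2)
  have h2 : (1 : ℝ) ≤ k i + 1 := by simp
  exact one_le_mul_of_one_le_of_one_le h2 h1

theorem absConv_of_bounded {F : MvPowerSeries (Fin m) ℂ} {C : ℝ}
    (hF : ∀ k, ‖MvPowerSeries.coeff k F‖ ≤ C) {z : Fin m → ℂ} (hz : ∀ i, ‖z i‖ < 1) :
    AbsConv F z := by
  have hC : 0 ≤ C := (norm_nonneg _).trans (hF 0)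
  refine absConv_of_norm_coeff_le (ρ := fun _ => 1) (C := C) (fun _ => one_pos) (fun k => ?_)
    fun i => by simpa using hz i
  exact (hF k).trans (le_mul_of_one_le_right hC
    (one_le_prod_succ_mul (ρ := fun _ => 1) (fun _ => ⟨one_pos, le_rfl⟩) k))

/-! ### Rounding to integer coefficients -/

/-- The series `h` with coefficients in `[0, 1)` for which `g + p * h` has integer coefficients,
where `p` has constant coefficient `1`. -/
noncomputable def roundingCoeff (g p : MvPowerSeries (Fin m) ℝ) : MvPowerSeries (Fin m) ℝ
  | k => Int.fract (-(MvPowerSeries.coeff k g + ∑ x ∈ antidiagonal k,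
      if _ : x.2 < k then MvPowerSeries.coeff x.1 p * roundingCoeff g p x.2 else 0))
termination_by k => k

theorem coeff_roundingCoeff (g p : MvPowerSeries (Fin m) ℝ) (k : Fin m →₀ ℕ) :
    MvPowerSeries.coeff k (roundingCoeff g p) =
      Int.fract (-(MvPowerSeries.coeff k g + ∑ x ∈ antidiagonal k,
        if x.2 < k then MvPowerSeries.coeff x.1 p *
          MvPowerSeries.coeff x.2 (roundingCoeff g p) else 0)) := by
  change roundingCoeff g p k = _
  rw [roundingCoeff]
  rfl

/-- As `p` has constant coefficient `1`, the coefficient of `p * h` at `k` is `h k` plus terms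
involving `h` only at indices below `k`. Hence `h k` can be chosen recursively as the fractional
part that completes the sum to an integer. -/
theorem exists_integral_add_mul (g p : MvPowerSeries (Fin m) ℝ)
    (hp : MvPowerSeries.coeff 0 p = 1) :
    ∃ (q : MvPowerSeries (Fin m) ℤ) (h : MvPowerSeries (Fin m) ℝ),
      (∀ k, |MvPowerSeries.coeff k h| ≤ 1) ∧
      MvPowerSeries.map (Int.castRingHom ℝ) q = g + p * h := by
  classical
  set h := roundingCoeff g p with hh
  have key : ∀ k, ∃ n : ℤ, (n : ℝ) = MvPowerSeries.coeff k (g + p * h) := by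
    intro k
    set r := ∑ x ∈ antidiagonal k, if x.2 < k then MvPowerSeries.coeff x.1 p *
          MvPowerSeries.coeff x.2 h else 0 with hr
    have h1 : MvPowerSeries.coeff k (p * h) = r + MvPowerSeries.coeff k h := by
      rw [MvPowerSeries.coeff_mul, hr]
      have : MvPowerSeries.coeff k h = ∑ x ∈ antidiagonal k,
          if (0, k) = x then MvPowerSeries.coeff k h else 0 := by
        rw [sum_ite_eq, if_pos (by simp)]
      rw [this, ← sum_add_distrib]
      refine sum_congr rfl fun x hx => ?_
      obtain ⟨a, b⟩ := x
      have hab : a + b = k := mem_antidiagonal.1 hx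
      by_cases ha : a = 0
      · subst ha
        have hb : b = k := by simpa using hab
        subst hb
        simp [hp]
      · have hlt : b < k := by
          rw [← hab]
          exact lt_add_of_pos_left b (pos_iff_ne_zero.2 ha)
        rw [if_pos hlt, if_neg (by simpa [Prod.ext_iff] using fun h => absurd h.symm ha)]
        simp
    refine ⟨-⌊-(MvPowerSeries.coeff k g + r)⌋, ?_⟩
    rw [map_add, h1, hh, coeff_roundingCoeff, ← hh, ← hr, Int.fract]
    push_cast
    ring
  choose q hq using key
  refine ⟨(q : MvPowerSeries (Fin m) ℤ), h, fun k => ?_, ?_⟩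
  · rw [hh, coeff_roundingCoeff, abs_of_nonneg (Int.fract_nonneg _)]
    exact (Int.fract_lt_one _).le
  · ext k
    rw [← hq k]
    rfl

theorem abs_coeff_coe_mul_le (p : MvPolynomial (Fin m) ℝ) {h : MvPowerSeries (Fin m) ℝ}
    (hh : ∀ k, |MvPowerSeries.coeff k h| ≤ 1) (k : Fin m →₀ ℕ) :
    |MvPowerSeries.coeff k ((p : MvPowerSeries (Fin m) ℝ) * h)| ≤
      ∑ d ∈ p.support, |p.coeff d| := by
  classical
  rw [MvPowerSeries.coeff_mul]
  calc |∑ x ∈ antidiagonal k, MvPowerSeries.coeff x.1 (p : MvPowerSeries (Fin m) ℝ) *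
        MvPowerSeries.coeff x.2 h| ≤ ∑ x ∈ antidiagonal k, |p.coeff x.1| := by
        refine (abs_sum_le_sum_abs _ _).trans (sum_le_sum fun x _ => ?_)
        rw [abs_mul, MvPolynomial.coeff_coe]
        exact mul_le_of_le_one_right (abs_nonneg _) (hh _)
    _ = ∑ d ∈ (antidiagonal k).image Prod.fst, |p.coeff d| := by
        refine (sum_image (f := fun d => |p.coeff d|) fun x hx y hy hxy => ?_).symm
        refine Prod.ext hxy (add_left_cancel (a := x.1) ?_)
        rw [mem_antidiagonal.1 hx, hxy, mem_antidiagonal.1 hy]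
    _ ≤ ∑ d ∈ (antidiagonal k).image Prod.fst ∪ p.support, |p.coeff d| :=
        sum_le_sum_of_subset_of_nonneg subset_union_left fun _ _ _ => abs_nonneg _
    _ = ∑ d ∈ p.support, |p.coeff d| := by
        refine (sum_subset subset_union_right fun d _ hd => ?_).symm
        rw [MvPolynomial.notMem_support_iff.1 hd, abs_zero]

theorem map_coe_eq_coe_map (P : MvPolynomial (Fin m) ℝ) :
    MvPowerSeries.map (algebraMap ℝ ℂ) (P : MvPowerSeries (Fin m) ℝ) =
      (MvPolynomial.map (algebraMap ℝ ℂ) P : MvPolynomial (Fin m) ℂ) := by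
  ext k
  rw [MvPowerSeries.coeff_map, MvPolynomial.coeff_coe, MvPolynomial.coeff_coe,
    MvPolynomial.coeff_map]

theorem eval_map_eq_aeval (P : MvPolynomial (Fin m) ℝ) (z : Fin m → ℂ) :
    MvPolynomial.eval z (MvPolynomial.map (algebraMap ℝ ℂ) P) = MvPolynomial.aeval z P := by
  rw [MvPolynomial.eval_map, MvPolynomial.aeval_def]

/-- A real polynomial can be modified, by a multiple of a real polynomial `p` with constant term
`1`, to a power series with bounded integer coefficients. -/
theorem exists_integral_toFun_eq (p Q : MvPolynomial (Fin m) ℝ) (hp : p.coeff 0 = 1) :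
    ∃ C : ℝ, ∀ R : MvPolynomial (Fin m) ℝ, (∀ k, |R.coeff k| ≤ 1) →
      ∃ q : MvPowerSeries (Fin m) ℤ, (∀ k, |((MvPowerSeries.coeff k q : ℤ) : ℝ)| ≤ C) ∧
        ∀ z : Fin m → ℂ, (∀ i, ‖z i‖ < 1) → MvPolynomial.aeval z p = 0 →
          toFun (toComplex q) z = MvPolynomial.aeval z Q * MvPolynomial.aeval z R := by
  -- The bound does not depend on `R`: both `R` and the rounding series have coefficients of modulus
  -- at most `1`.
  refine ⟨∑ d ∈ Q.support, |Q.coeff d| + ∑ d ∈ p.support, |p.coeff d|, fun R hR => ?_⟩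
  obtain ⟨q, h, hh, hq⟩ := exists_integral_add_mul
    ((Q : MvPowerSeries (Fin m) ℝ) * (R : MvPowerSeries (Fin m) ℝ)) p (by simpa using hp)
  refine ⟨q, fun k => ?_, fun z hz hpz => ?_⟩
  · have hk := congrArg (MvPowerSeries.coeff k) hq
    simp only [MvPowerSeries.coeff_map, map_add, eq_intCast] at hk
    rw [hk]
    exact (abs_add_le _ _).trans (add_le_add (abs_coeff_coe_mul_le Q (by simpa using hR) k)
      (abs_coeff_coe_mul_le p hh k))
  · have hq' : toComplex q = (MvPolynomial.map (algebraMap ℝ ℂ) (Q * R) : MvPolynomial (Fin m) ℂ) +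
        (MvPolynomial.map (algebraMap ℝ ℂ) p : MvPolynomial (Fin m) ℂ) *
          MvPowerSeries.map (algebraMap ℝ ℂ) h := by
      rw [← map_coe_eq_coe_map, ← map_coe_eq_coe_map, ← map_mul, ← map_add, MvPolynomial.coe_mul,
        ← hq]
      ext k
      simp [toComplex]
    have hc : AbsConv (MvPowerSeries.map (algebraMap ℝ ℂ) h) z :=
      absConv_of_bounded (C := 1) (fun k => by simpa using hh k) hz
    rw [hq', toFun_add (absConv_coe _ _) ((absConv_coe _ _).mul hc), toFun_mul (absConv_coe _ _) hc,
      toFun_coe, toFun_coe, eval_map_eq_aeval, eval_map_eq_aeval, hpz, zero_mul, add_zero, map_mul]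

/-! ### Real polynomials with prescribed values, and small perturbations -/

/-- Coordinatewise complex conjugation. -/
def conjPt (z : Fin m → ℂ) : Fin m → ℂ := fun i => starRingEnd ℂ (z i)

theorem conjPt_conjPt (z : Fin m → ℂ) : conjPt (conjPt z) = z := by
  ext i
  simp [conjPt]

/-- The product `(zᵢ - aᵢ)(zⱼ - conj aⱼ)` vanishes at `a` and at `conjPt a`, and not at `b` for
suitable `i`, `j`. Writing it as `A + i B` with `A`, `B` real, both parts vanish at `a`, and at
least one does not vanish at `b`. -/
theorem exists_aeval_eq_zero_of_ne {a b : Fin m → ℂ} (h1 : b ≠ a) (h2 : b ≠ conjPt a) :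
    ∃ Q : MvPolynomial (Fin m) ℝ, MvPolynomial.aeval a Q = 0 ∧ MvPolynomial.aeval b Q ≠ 0 := by
  obtain ⟨i, hi⟩ := Function.ne_iff.1 h1
  obtain ⟨j, hj⟩ := Function.ne_iff.1 h2
  let A : MvPolynomial (Fin m) ℝ := .X i * .X j - .C (a j).re * .X i - .C (a i).re * .X j +
    .C ((a i).re * (a j).re + (a i).im * (a j).im)
  let B : MvPolynomial (Fin m) ℝ := .C (a j).im * .X i - .C (a i).im * .X j +
    .C ((a i).im * (a j).re - (a i).re * (a j).im)
  have hA : MvPolynomial.aeval a A = 0 := by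
    simp only [A, map_add, map_sub, map_mul, MvPolynomial.aeval_X, MvPolynomial.aeval_C]
    apply Complex.ext <;> simp <;> ring
  have hB : MvPolynomial.aeval a B = 0 := by
    simp only [B, map_add, map_sub, map_mul, MvPolynomial.aeval_X, MvPolynomial.aeval_C]
    apply Complex.ext <;> simp <;> ring
  have hAB : MvPolynomial.aeval b A + Complex.I * MvPolynomial.aeval b B =
      (b i - a i) * (b j - starRingEnd ℂ (a j)) := by
    simp only [A, B, map_add, map_sub, map_mul, MvPolynomial.aeval_X, MvPolynomial.aeval_C]
    apply Complex.ext <;> simp <;> ring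
  by_cases hb : MvPolynomial.aeval b A = 0
  · refine ⟨B, hB, fun hb' => ?_⟩
    rw [hb, hb', mul_zero, add_zero] at hAB
    exact mul_ne_zero (sub_ne_zero.2 hi) (sub_ne_zero.2 hj) hAB.symm
  · exact ⟨A, hA, hb⟩

theorem exists_aeval_eq_zero_coeff_zero {a : Fin m → ℂ} (ha : a ≠ 0) :
    ∃ p : MvPolynomial (Fin m) ℝ, MvPolynomial.aeval a p = 0 ∧ p.coeff 0 = 1 := by
  obtain ⟨i, hi⟩ := Function.ne_iff.1 ha
  have hn : Complex.normSq (a i) ≠ 0 := by simpa using hi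
  -- This is `(1 - zᵢ / aᵢ)(1 - zᵢ / conj aᵢ)`.
  refine ⟨1 + .X i * (.C (-(2 * (a i).re / Complex.normSq (a i))) +
    .C (1 / Complex.normSq (a i)) * .X i), ?_, ?_⟩
  · have h : (Complex.normSq (a i) : ℂ) ≠ 0 := by exact_mod_cast hn
    simp only [map_add, map_one, map_mul, MvPolynomial.aeval_X, MvPolynomial.aeval_C]
    have h3 : a i * a i - 2 * (a i).re * a i + Complex.normSq (a i) = 0 := by
      apply Complex.ext <;> simp [Complex.normSq_apply] <;> ring
    simp only [Complex.coe_algebraMap]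
    push_cast
    field_simp
    linear_combination h3
  · rw [← MvPolynomial.constantCoeff_eq]
    simp

/-- A constant suffices when `b` is real. Otherwise some `bᵢ` is nonreal, so `1` and `bᵢ` span `ℂ`
over `ℝ` and `x + y zᵢ` takes the value `c`; `δ` is chosen to make `|x|, |y| ≤ 1`. -/
theorem exists_aeval_eq_of_small (b : Fin m → ℂ) :
    ∃ δ > 0, ∀ c : ℂ, ‖c‖ < δ → ((∀ i, (b i).im = 0) → c.im = 0) →
      ∃ R : MvPolynomial (Fin m) ℝ, (∀ k, |R.coeff k| ≤ 1) ∧ MvPolynomial.aeval b R = c := by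
  classical
  by_cases hb : ∀ i, (b i).im = 0
  · refine ⟨1, one_pos, fun c hc hr => ⟨.C c.re, fun k => ?_, ?_⟩⟩
    · rw [MvPolynomial.coeff_C]
      split_ifs
      · exact (Complex.abs_re_le_norm c).trans hc.le
      · simp
    · rw [MvPolynomial.aeval_C]
      apply Complex.ext <;> simp [hr hb]
  · push Not at hb
    obtain ⟨i, hi⟩ := hb
    have hpos : 0 < |(b i).im| := abs_pos.2 hi
    have hden : 0 < 1 + |(b i).im| + |(b i).re| := by positivity
    refine ⟨|(b i).im| / (1 + |(b i).im| + |(b i).re|), by positivity, fun c hc _ => ?_⟩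
    have hre := (Complex.abs_re_le_norm c).trans hc.le
    have him := (Complex.abs_im_le_norm c).trans hc.le
    have hy : |c.im / (b i).im| ≤ 1 / (1 + |(b i).im| + |(b i).re|) := by
      rw [abs_div, div_le_iff₀ hpos]
      exact him.trans_eq (by ring)
    have hx : |c.re - c.im / (b i).im * (b i).re| ≤ 1 := by
      refine (abs_sub _ _).trans ?_
      rw [abs_mul]
      refine (add_le_add hre (mul_le_mul_of_nonneg_right hy (abs_nonneg _))).trans ?_
      rw [div_mul_eq_mul_div, ← add_div, div_le_one hden]
      linarith
    refine ⟨.C (c.re - c.im / (b i).im * (b i).re) + .C (c.im / (b i).im) * .X i,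
      fun k => ?_, ?_⟩
    · rw [MvPolynomial.coeff_add, MvPolynomial.coeff_C, MvPolynomial.coeff_C_mul,
        MvPolynomial.coeff_X]
      have hy' : |c.im / (b i).im| ≤ 1 := hy.trans ((div_le_one hden).2 (by
        linarith [abs_nonneg (b i).re]))
      by_cases h0 : 0 = k
      · subst h0
        simpa using hx
      · rw [if_neg h0]
        split_ifs
        · simpa using hy'
        · simp
    · simp only [map_add, map_mul, MvPolynomial.aeval_X, MvPolynomial.aeval_C]
      apply Complex.ext
      · simp
      · simp [hi]

/-- The target is some `r + s i` with `r`, `s` rational and close to `v`. Of two candidates for `r`,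
at least one differs from the real part of `u`. -/
theorem exists_small_isAlgebraic_add (v u : ℂ) {δ : ℝ} (hδ : 0 < δ) :
    ∃ c : ℂ, ‖c‖ < δ ∧ (v.im = 0 → c.im = 0) ∧ IsAlgebraic ℚ (v + c) ∧ v + c ≠ u := by
  obtain ⟨s, hs, hs0⟩ : ∃ s : ℚ, |(s : ℝ) - v.im| < δ / 2 ∧ (v.im = 0 → s = 0) := by
    by_cases h : v.im = 0
    · exact ⟨0, by simpa [h] using hδ, fun _ => rfl⟩
    · obtain ⟨s, h1, h2⟩ := exists_rat_btwn (show v.im < v.im + δ / 2 by linarith)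
      exact ⟨s, by rw [abs_of_pos] <;> linarith, fun h' => absurd h' h⟩
  obtain ⟨r, hr, hru⟩ : ∃ r : ℚ, |(r : ℝ) - v.re| < δ / 2 ∧ (r : ℝ) ≠ u.re := by
    obtain ⟨r, h1, h2⟩ := exists_rat_btwn (show v.re < v.re + δ / 2 by linarith)
    obtain ⟨r', h3, h4⟩ := exists_rat_btwn h2
    by_cases h : (r : ℝ) = u.re
    · exact ⟨r', by rw [abs_of_pos] <;> linarith, by linarith⟩
    · exact ⟨r, by rw [abs_of_pos] <;> linarith, h⟩
  have hsum : v + ((r : ℝ) - v.re + ((s : ℝ) - v.im) * Complex.I : ℂ) =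
      (r : ℂ) + (s : ℂ) * Complex.I := by
    apply Complex.ext <;> simp
  refine ⟨(r : ℝ) - v.re + ((s : ℝ) - v.im) * Complex.I, ?_, fun h => ?_, ?_, fun h => hru ?_⟩
  · refine (Complex.norm_le_abs_re_add_abs_im _).trans_lt ?_
    simp only [Complex.add_re, Complex.sub_re, Complex.ofReal_re, Complex.mul_re, Complex.I_re,
      Complex.sub_im, Complex.ofReal_im, Complex.I_im, Complex.add_im, Complex.mul_im]
    simpa using (add_lt_add hr hs).trans_eq (add_halves δ)
  · simp [h, hs0 h]
  · rw [hsum]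
    have hI : IsAlgebraic ℚ Complex.I := by
      refine IsIntegral.isAlgebraic ⟨Polynomial.X ^ 2 + 1, ?_, by simp⟩
      simpa using Polynomial.monic_X_pow_add_C (1 : ℚ) two_ne_zero
    exact (isAlgebraic_ratCast ℚ r).add ((isAlgebraic_ratCast ℚ s).mul hI)
  · rw [← h, hsum]
    simp

/-- Only countably many real shifts are excluded, so the admissible ones are dense. -/
theorem exists_small_not_isAlgebraic_add (v u : ℂ) {δ : ℝ} (hδ : 0 < δ) :
    ∃ c : ℂ, ‖c‖ < δ ∧ c.im = 0 ∧ ¬ IsAlgebraic ℚ (v + c) ∧ v + c ≠ u := by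
  have hc : {t : ℝ | v + (t : ℂ) ∈ {x : ℂ | IsAlgebraic ℚ x} ∪ {u}}.Countable := by
    refine (((Algebraic.countable ℚ ℂ).union (Set.countable_singleton u))).preimage_of_injOn
      (f := fun t : ℝ => v + (t : ℂ)) ?_
    intro s _ t _ h
    simpa using h
  obtain ⟨t, ht, htδ⟩ := (hc.dense_compl ℝ).exists_dist_lt 0 hδ
  simp only [Set.mem_compl_iff, Set.mem_ofPred_eq, Set.mem_union, Set.mem_singleton_iff,
    not_or] at ht
  exact ⟨t, by simpa using htδ, by simp, ht.1, ht.2⟩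

theorem exists_small_isAlgebraic_add_iff (v u : ℂ) (A : Prop) {δ : ℝ} (hδ : 0 < δ) :
    ∃ c : ℂ, ‖c‖ < δ ∧ (v.im = 0 → c.im = 0) ∧ (IsAlgebraic ℚ (v + c) ↔ A) ∧ v + c ≠ u := by
  by_cases hA : A
  · obtain ⟨c, h1, h2, h3, h4⟩ := exists_small_isAlgebraic_add v u hδ
    exact ⟨c, h1, h2, iff_of_true h3 hA, h4⟩
  · obtain ⟨c, h1, h2, h3, h4⟩ := exists_small_not_isAlgebraic_add v u hδ
    exact ⟨c, h1, fun _ => h2, iff_of_false h3 hA, h4⟩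

/-! ### Conjugation symmetry and the correction step -/

theorem conj_term_toComplex (f : MvPowerSeries (Fin m) ℤ) (z : Fin m → ℂ) (k : Fin m →₀ ℕ) :
    term (toComplex f) (conjPt z) k = starRingEnd ℂ (term (toComplex f) z k) := by
  simp [term, toComplex, conjPt, map_prod]

theorem toFun_conjPt (f : MvPowerSeries (Fin m) ℤ) (z : Fin m → ℂ) :
    toFun (toComplex f) (conjPt z) = starRingEnd ℂ (toFun (toComplex f) z) := by
  rw [toFun, toFun, Complex.conj_tsum]
  exact tsum_congr fun k => conj_term_toComplex f z k

theorem aeval_conjPt (P : MvPolynomial (Fin m) ℝ) (z : Fin m → ℂ) :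
    MvPolynomial.aeval (conjPt z) P = starRingEnd ℂ (MvPolynomial.aeval z P) := by
  simp only [MvPolynomial.aeval_def, MvPolynomial.eval₂_eq', map_sum, map_mul, map_prod, map_pow,
    conjPt, Complex.coe_algebraMap, Complex.conj_ofReal]

theorem conjPt_eq_self {z : Fin m → ℂ} (hz : ∀ i, (z i).im = 0) : conjPt z = z :=
  funext fun i => Complex.conj_eq_iff_im.2 (hz i)

/-- An integral power series with small coefficients which vanishes on a finite set `E` and moves
the value `v` at a point `b` to an algebraic or a transcendental number, as wanted. -/
theorem exists_integral_correction (E : Finset (Fin m → ℂ)) (hE0 : ∀ a ∈ E, a ≠ 0)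
    (hE1 : ∀ a ∈ E, ∀ i, ‖a i‖ < 1) {b : Fin m → ℂ} (hb0 : b ≠ 0) (hb1 : ∀ i, ‖b i‖ < 1)
    (hbE : ∀ a ∈ E, b ≠ a ∧ b ≠ conjPt a) {ε : ℝ} (hε : 0 < ε) (v u : ℂ)
    (hv : (∀ i, (b i).im = 0) → v.im = 0) (A : Prop) :
    ∃ q : MvPowerSeries (Fin m) ℤ,
      (∀ k, |((MvPowerSeries.coeff k q : ℤ) : ℝ)| ≤ ε * k.degree) ∧
      (∀ a ∈ E, toFun (toComplex q) a = 0) ∧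
      (IsAlgebraic ℚ (v + toFun (toComplex q) b) ↔ A) ∧ v + toFun (toComplex q) b ≠ u := by
  classical
  obtain ⟨j, hj⟩ := Function.ne_iff.1 hb0
  have hQ : ∀ a : Fin m → ℂ, ∃ Q : MvPolynomial (Fin m) ℝ,
      a ∈ E → MvPolynomial.aeval a Q = 0 ∧ MvPolynomial.aeval b Q ≠ 0 := by
    intro a
    by_cases ha : a ∈ E
    · obtain ⟨Q, hQ⟩ := exists_aeval_eq_zero_of_ne (hbE a ha).1 (hbE a ha).2
      exact ⟨Q, fun _ => hQ⟩
    · exact ⟨0, fun h => absurd h ha⟩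
  choose Q hQ using hQ
  have hp : ∀ a : Fin m → ℂ, ∃ p : MvPolynomial (Fin m) ℝ, p.coeff 0 = 1 ∧
      (a ≠ 0 → MvPolynomial.aeval a p = 0) := by
    intro a
    by_cases ha : a = 0
    · exact ⟨1, by simp, fun h => absurd ha h⟩
    · obtain ⟨p, hp, hp0⟩ := exists_aeval_eq_zero_coeff_zero ha
      exact ⟨p, hp0, fun _ => hp⟩
  choose p hp0 hp using hp
  set Q' := ∏ a ∈ E, Q a with hQ'
  have hQ'E : ∀ a ∈ E, MvPolynomial.aeval a Q' = 0 := fun a ha => by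
    rw [hQ', map_prod]
    exact prod_eq_zero ha (hQ a ha).1
  have hQ'b : MvPolynomial.aeval b Q' ≠ 0 := by
    rw [hQ', map_prod]
    exact prod_ne_zero_iff.2 fun a ha => (hQ a ha).2
  -- The point `b` is included so that rounding does not disturb the value there either.
  set p' := ∏ a ∈ insert b E, p a with hp'
  have hp'E : ∀ a ∈ insert b E, MvPolynomial.aeval a p' = 0 := fun a ha => by
    rw [hp', map_prod]
    refine prod_eq_zero ha (hp a ?_)
    rcases mem_insert.1 ha with rfl | ha
    exacts [hb0, hE0 a ha]
  have hp'0 : p'.coeff 0 = 1 := by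
    rw [← MvPolynomial.constantCoeff_eq, hp', map_prod]
    exact prod_eq_one fun a _ => hp0 a
  obtain ⟨C, hC⟩ := exists_integral_toFun_eq p' Q' hp'0
  obtain ⟨δ, hδ, hR⟩ := exists_aeval_eq_of_small b
  -- After multiplication by `zⱼᴺ` only indices with `N ≤ k j` survive, and there `C ≤ ε N ≤ ε |k|`.
  -- Since `C` is uniform in `R`, this can be fixed before `R` is chosen.
  obtain ⟨N, hN⟩ := exists_nat_ge (C / ε)
  rw [div_le_iff₀ hε] at hN
  set w := b j ^ N * MvPolynomial.aeval b Q' with hw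
  have hw0 : w ≠ 0 := mul_ne_zero (pow_ne_zero _ hj) hQ'b
  obtain ⟨c, hc, hcim, hcA, hcu⟩ := exists_small_isAlgebraic_add_iff v u A
    (mul_pos hδ (norm_pos_iff.2 hw0))
  -- The correction at `b` will be `w * R(b)`, so `R(b) = c / w` is required. At a real point `b`
  -- this quotient must be real, as `w` and `c` then are.
  obtain ⟨R, hR1, hRb⟩ := hR (c / w) (by rwa [norm_div, div_lt_iff₀ (norm_pos_iff.2 hw0)]) (by
    intro hreal
    have h1 : starRingEnd ℂ c = c := Complex.conj_eq_iff_im.2 (hcim (hv hreal))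
    have h2 : starRingEnd ℂ w = w := by
      rw [hw, map_mul, map_pow, ← aeval_conjPt, conjPt_eq_self hreal,
        Complex.conj_eq_iff_im.2 (hreal j)]
    rw [← Complex.conj_eq_iff_im, map_div₀, h1, h2])
  obtain ⟨q, hq1, hq⟩ := hC R hR1
  have hval : ∀ a ∈ insert b E, toFun (toComplex (MvPowerSeries.monomial (Finsupp.single j N) 1 * q)) a
      = a j ^ N * (MvPolynomial.aeval a Q' * MvPolynomial.aeval a R) := by
    intro a ha
    have ha1 : ∀ i, ‖a i‖ < 1 := by
      rcases mem_insert.1 ha with rfl | ha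
      exacts [hb1, hE1 a ha]
    have hmon : toComplex (MvPowerSeries.monomial (Finsupp.single j N) (1 : ℤ)) =
        ((MvPolynomial.monomial (Finsupp.single j N) 1 : MvPolynomial (Fin m) ℂ) :
          MvPowerSeries (Fin m) ℂ) := by
      ext k
      simp [toComplex, MvPowerSeries.coeff_monomial]
    have hqc : AbsConv (toComplex q) a :=
      absConv_of_bounded (C := C) (fun k => by simpa [toComplex] using hq1 k) ha1
    rw [toComplex, map_mul, ← toComplex, ← toComplex, hmon, toFun_mul (absConv_coe _ _) hqc,
      toFun_coe, hq a ha1 (hp'E a ha), MvPolynomial.eval_monomial]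
    simp
  refine ⟨MvPowerSeries.monomial (Finsupp.single j N) 1 * q, fun k => ?_, fun a ha => ?_, ?_⟩
  · rw [MvPowerSeries.coeff_monomial_mul]
    split_ifs with hk
    · rw [one_mul]
      refine (hq1 _).trans (hN.trans ?_)
      rw [mul_comm]
      refine mul_le_mul_of_nonneg_left ?_ hε.le
      have h1 : N ≤ k j := by simpa using hk j
      exact_mod_cast h1.trans (Finsupp.le_degree j k)
    · simpa using by positivity
  · rw [hval a (mem_insert_of_mem ha), hQ'E a ha]
    simp
  · have : toFun (toComplex (MvPowerSeries.monomial (Finsupp.single j N) 1 * q)) b = c := by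
      rw [hval b (mem_insert_self _ _), hRb, ← mul_assoc, ← hw, mul_div_cancel₀ _ hw0]
    rw [this]
    exact ⟨hcA, hcu⟩

theorem isAlgebraic_conj_iff (x : ℂ) : IsAlgebraic ℚ (starRingEnd ℂ x) ↔ IsAlgebraic ℚ x := by
  refine ⟨fun h => ?_, fun h => IsAlgebraic.algHom (Complex.conjAe.toAlgHom.restrictScalars ℚ) h⟩
  simpa using IsAlgebraic.algHom (Complex.conjAe.toAlgHom.restrictScalars ℚ) h

/-! ### Enumeration of algebraic points -/

/-- The nonzero algebraic points of a polydisc can be enumerated up to complex conjugation,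
without repetition. -/
theorem exists_enumeration_algebraicPoints (hm : 1 ≤ m) {ρ : Fin m → ℝ} (hρ : ∀ i, 0 < ρ i) :
    ∃ α : ℕ → Fin m → ℂ, (∀ n, α n ∈ algebraicPoints (polydisc 0 ρ) ∧ α n ≠ 0) ∧
      (∀ i j, i ≠ j → α j ≠ α i ∧ α j ≠ conjPt (α i)) ∧
      ∀ z ∈ algebraicPoints (polydisc 0 ρ), z ≠ 0 → ∃ n, z = α n ∨ z = conjPt (α n) := by
  let B := {z : Fin m → ℂ // z ∈ algebraicPoints (polydisc 0 ρ) ∧ z ≠ 0}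
  let σ : Setoid B :=
    { r := fun x y => y.1 = x.1 ∨ y.1 = conjPt x.1
      iseqv :=
        { refl := fun _ => Or.inl rfl
          symm := by
            rintro x y (h | h)
            · exact Or.inl h.symm
            · exact Or.inr (by rw [h, conjPt_conjPt])
          trans := by
            rintro x y z (h | h) (h' | h') <;> rw [h', h]
            · exact Or.inl rfl
            · exact Or.inr rfl
            · exact Or.inr rfl
            · exact Or.inl (conjPt_conjPt _) } }
  have hcount : Countable B := by
    have h : (Set.univ.pi fun _ : Fin m => {x : ℂ | IsAlgebraic ℚ x}).Countable :=
      Set.countable_univ_pi fun _ => Algebraic.countable ℚ ℂ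
    have hsub : {z : Fin m → ℂ | z ∈ algebraicPoints (polydisc 0 ρ) ∧ z ≠ 0} ⊆
        Set.univ.pi fun _ : Fin m => {x : ℂ | IsAlgebraic ℚ x} := fun z hz i _ => hz.1.2 i
    exact (h.mono hsub).to_subtype
  have hinf : Infinite (Quotient σ) := by
    have : Nonempty (Fin m) := ⟨⟨0, hm⟩⟩
    obtain ⟨i₀, hi₀⟩ := Finite.exists_min ρ
    obtain ⟨r, hr0, hr⟩ := exists_rat_btwn (hρ i₀)
    have hr0' : 0 < r := by exact_mod_cast hr0
    -- The diagonal points with all coordinates `r / (n + 1)` are real, so distinct ones are not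
    -- conjugate.
    let x : ℕ → ℚ := fun n => r / (n + 1)
    have hx0 : ∀ n, 0 < x n := fun n => by positivity
    have hxr : ∀ n, x n ≤ r := fun n => div_le_self hr0'.le (by simp)
    let pt : ℕ → B := fun n => ⟨fun _ => (x n : ℂ), ⟨fun i => by
        simp only [Pi.zero_apply, sub_zero]
        rw [← Complex.ofReal_ratCast, Complex.norm_real, Real.norm_of_nonneg
          (by exact_mod_cast (hx0 n).le)]
        exact ((Rat.cast_le.2 (hxr n)).trans_lt hr).trans_le (hi₀ i),
        fun i => isAlgebraic_ratCast ℚ _⟩,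
      fun h => (hx0 n).ne' (by simpa using congrFun h ⟨0, hm⟩)⟩
    refine Infinite.of_injective (fun n => (Quotient.mk σ (pt n))) fun a b hab => ?_
    have hxx : x b = x a := by
      rcases Quotient.exact hab with h | h
      · simpa [pt] using congrFun h ⟨0, hm⟩
      · simpa [pt, conjPt] using congrFun h ⟨0, hm⟩
    have h3 : r * (a + 1) = r * (b + 1) := by
      have h1 : (a : ℚ) + 1 ≠ 0 := by positivity
      have h2 : (b : ℚ) + 1 ≠ 0 := by positivity
      exact (div_eq_div_iff h2 h1).1 hxx
    exact_mod_cast add_right_cancel (mul_left_cancel₀ hr0'.ne' h3)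
  obtain ⟨e⟩ : Nonempty (ℕ ≃ Quotient σ) := nonempty_equiv_of_countable
  have hne : ∀ i j, i ≠ j → ¬ σ.r (e i).out (e j).out := by
    intro i j hij h
    refine hij (e.injective ?_)
    rw [← Quotient.out_eq (e i), ← Quotient.out_eq (e j)]
    exact Quotient.sound h
  refine ⟨fun n => (e n).out.1, fun n => (e n).out.2, fun i j hij => ?_, fun z hz hz0 => ?_⟩
  · exact ⟨fun h => hne i j hij (Or.inl h), fun h => hne i j hij (Or.inr h)⟩
  · refine ⟨e.symm (Quotient.mk σ ⟨z, hz, hz0⟩), ?_⟩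
    simp only [Equiv.apply_symm_apply]
    exact Quotient.mk_out (s := σ) ⟨z, hz, hz0⟩

/-! ### Summing the corrections -/

/-- Integral power series whose coefficients are dominated by a geometric series sum to an
integral power series. -/
theorem exists_hasSum_toFun (q : ℕ → MvPowerSeries (Fin m) ℤ)
    (hq : ∀ n k, |((MvPowerSeries.coeff k (q n) : ℤ) : ℝ)| ≤ 1 / 2 / 2 ^ n * k.degree) :
    ∃ s : MvPowerSeries (Fin m) ℤ,
      (∀ k, |((MvPowerSeries.coeff k s : ℤ) : ℝ)| ≤ k.degree) ∧
      ∀ z : Fin m → ℂ, (∀ i, ‖z i‖ < 1) →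
        HasSum (fun n => toFun (toComplex (q n)) z) (toFun (toComplex s) z) := by
  -- For `n ≥ |k|` one has `|k| < 2 ^ n`, so the integer coefficient of `q n` at `k` has modulus
  -- below `1` and is zero. The sum at each index is therefore finite.
  let s : MvPowerSeries (Fin m) ℤ := fun k =>
    ∑ n ∈ range k.degree, MvPowerSeries.coeff k (q n)
  have hs : ∀ k, MvPowerSeries.coeff k s = ∑ n ∈ range k.degree, MvPowerSeries.coeff k (q n) :=
    fun _ => rfl
  have hzero : ∀ k, ∀ n ∉ range k.degree, MvPowerSeries.coeff k (q n) = 0 := by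
    intro k n hn
    have hn' : k.degree ≤ n := by simpa using hn
    have h1 : (k.degree : ℝ) < 2 ^ n := by
      exact_mod_cast hn'.trans_lt (Nat.lt_two_pow_self (n := n))
    have h2 : |((MvPowerSeries.coeff k (q n) : ℤ) : ℝ)| < 1 := by
      refine (hq n k).trans_lt ?_
      rw [div_mul_eq_mul_div, div_lt_one (by positivity)]
      have : (0 : ℝ) ≤ k.degree := by positivity
      linarith
    exact Int.abs_lt_one_iff.1 (by exact_mod_cast h2)
  have hgeo : HasSum (fun n : ℕ => (1 / 2 / 2 ^ n : ℝ)) 1 := hasSum_geometric_two' 1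
  refine ⟨s, fun k => ?_, fun z hz => ?_⟩
  · rw [hs]
    push_cast
    refine (abs_sum_le_sum_abs _ _).trans ((sum_le_sum fun n _ => hq n k).trans ?_)
    rw [← sum_mul]
    exact mul_le_of_le_one_left (by positivity)
      (sum_le_hasSum _ (fun n _ => by positivity) hgeo)
  -- The factor `|k|` is absorbed into `∏ (kᵢ + 1)`. Joint summability in `k` and `n` then allows
  -- the two summations to be exchanged.
  · have hdom : Summable fun x : (Fin m →₀ ℕ) × ℕ =>
        (∏ i, ((x.1 i + 1 : ℝ) * ‖z i‖ ^ x.1 i)) * (1 / 2 / 2 ^ x.2 : ℝ) :=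
      (summable_prod_succ_mul_pow (fun i => norm_nonneg (z i)) hz).mul_of_nonneg hgeo.summable
        (fun k => prod_nonneg fun i _ => by positivity) fun n => by positivity
    have hsum : Summable fun x : (Fin m →₀ ℕ) × ℕ => term (toComplex (q x.2)) z x.1 := by
      refine Summable.of_norm_bounded hdom fun x => ?_
      rw [term, norm_mul, norm_prod, prod_mul_distrib, mul_right_comm]
      simp only [norm_pow]
      refine mul_le_mul_of_nonneg_right ?_ (prod_nonneg fun i _ => by positivity)
      have : ‖MvPowerSeries.coeff x.1 (toComplex (q x.2))‖ =
          |((MvPowerSeries.coeff x.1 (q x.2) : ℤ) : ℝ)| := by simp [toComplex]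
      rw [this, mul_comm]
      exact (hq x.2 x.1).trans (mul_le_mul_of_nonneg_left (degree_le_prod_succ x.1)
        (by positivity))
    have hfib : ∀ k, HasSum (fun n => term (toComplex (q n)) z k) (term (toComplex s) z k) := by
      intro k
      have : term (toComplex s) z k = ∑ n ∈ range k.degree, term (toComplex (q n)) z k := by
        simp [term, toComplex, hs, sum_mul]
      rw [this]
      refine hasSum_sum_of_ne_finset_zero fun n hn => ?_
      simp [term, toComplex, hzero k n hn]
    have htot : toFun (toComplex s) z =
        ∑' x : (Fin m →₀ ℕ) × ℕ, term (toComplex (q x.2)) z x.1 :=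
      (hsum.hasSum.prod_fiberwise hfib).tsum_eq
    rw [htot]
    have hswap := (Equiv.prodComm ℕ (Fin m →₀ ℕ)).hasSum_iff.2 hsum.hasSum
    exact hswap.prod_fiberwise fun n => (hswap.summable.prod_factor n).hasSum

/-! ### Polyradius of convergence -/

theorem isOpen_polydisc (ρ : Fin m → ℝ) : IsOpen (polydisc 0 ρ) := by
  simp only [polydisc, Set.ofPred_forall]
  exact isOpen_iInter_of_finite fun i => isOpen_lt (by fun_prop) continuous_const

/-- If `‖z i‖ ≥ ρ i`, the terms in pure powers of the `i`-th variable have modulus at least `1`,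
both at `z` and at its outward dilations, so they cannot tend to zero. -/
theorem hasPolyradius_of_le_norm_coeff {ρ : Fin m → ℝ} (hρ : ∀ i, 0 < ρ i)
    {F : MvPowerSeries (Fin m) ℂ} (hF : ∀ z ∈ polydisc 0 ρ, AbsConv F z)
    (hlow : ∀ i N, (ρ i)⁻¹ ^ N ≤ ‖MvPowerSeries.coeff (Finsupp.single i N) F‖) :
    HasPolyradius F ρ := by
  refine Set.Subset.antisymm (fun z hz i => ?_) (interior_maximal hF (isOpen_polydisc ρ))
  rw [Pi.zero_apply, sub_zero]
  by_contra! hi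
  have hcont : Tendsto (fun t : ℝ => fun i => ((1 + t : ℝ) : ℂ) * z i) (𝓝 0) (𝓝 z) := by
    have : Continuous (fun t : ℝ => fun i => ((1 + t : ℝ) : ℂ) * z i) := by fun_prop
    simpa using this.tendsto 0
  have hev := (hcont.eventually (mem_interior_iff_mem_nhds.1 hz)).filter_mono
    (nhdsWithin_le_nhds (s := Set.Ioi 0))
  obtain ⟨t, hs, ht⟩ := (hev.and self_mem_nhdsWithin).exists
  have ht : 0 < t := ht
  have hs : AbsConv F fun i => ((1 + t : ℝ) : ℂ) * z i := hs
  have hlim := (Summable.comp_injective hs (Finsupp.single_injective i)).tendsto_atTop_zero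
  obtain ⟨N, hN⟩ := (hlim.eventually (gt_mem_nhds one_pos)).exists
  refine absurd hN (not_lt.2 ?_)
  have hterm : ∏ j, (((1 + t : ℝ) : ℂ) * z j) ^ (Finsupp.single i N) j =
      (((1 + t : ℝ) : ℂ) * z i) ^ N := by
    rw [prod_eq_single i (fun j _ hj => by simp [Finsupp.single_eq_of_ne hj]) (by simp)]
    simp
  simp only [Function.comp_apply, term]
  rw [hterm, norm_mul, norm_pow, norm_mul, Complex.norm_real,
    Real.norm_of_nonneg (by linarith)]
  have h1 : ρ i ≤ (1 + t) * ‖z i‖ := by nlinarith [norm_nonneg (z i)]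
  calc (1 : ℝ) = (ρ i)⁻¹ ^ N * ρ i ^ N := by
        rw [← mul_pow, inv_mul_cancel₀ (hρ i).ne', one_pow]
    _ ≤ _ := mul_le_mul (hlow i N) (pow_le_pow_left₀ (hρ i).le h1 N)
        (pow_nonneg (hρ i).le _) (norm_nonneg _)

theorem degree_le_prod_succ_mul {ρ : Fin m → ℝ} (hρ : ∀ i, 0 < ρ i ∧ ρ i ≤ 1)
    (k : Fin m →₀ ℕ) : (k.degree : ℝ) ≤ ∏ i, ((k i + 1 : ℝ) * (ρ i)⁻¹ ^ k i) := by
  refine (degree_le_prod_succ k).trans (prod_le_prod (fun i _ => by positivity) fun i _ => ?_)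
  exact le_mul_of_one_le_right (by positivity)
    (one_le_pow₀ ((one_le_inv₀ (hρ i).1).2 (hρ i).2))

/-! ### Construction of the series -/

/-- Integral power series with prescribed polyradius and exceptional set that avoids a given
sequence of power series. -/
theorem exists_exceptionalSet_eq (hm : 1 ≤ m) {ρ : Fin m → ℝ} (hρ : ∀ i, 0 < ρ i ∧ ρ i ≤ 1)
    {S : Set (Fin m → ℂ)} (hS : S ⊆ algebraicPoints (polydisc 0 ρ))
    (hconj : ∀ z ∈ S, conjPt z ∈ S) (hzero : (0 : Fin m → ℂ) ∈ S)
    (g : ℕ → MvPowerSeries (Fin m) ℤ) :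
    ∃ f : MvPowerSeries (Fin m) ℤ, HasPolyradius (toComplex f) ρ ∧
      (∀ z ∈ polydisc 0 ρ, AbsConv (toComplex f) z) ∧
      exceptionalSet (polydisc 0 ρ) (toFun (toComplex f)) = S ∧ ∀ n, f ≠ g n := by
  classical
  have hρ0 : ∀ i, 0 < ρ i := fun i => (hρ i).1
  have hunit : ∀ z ∈ polydisc 0 ρ, ∀ i, ‖z i‖ < 1 := fun z hz i =>
    (show ‖z i‖ < ρ i by simpa using hz i).trans_le (hρ i).2
  have hconv : ∀ (f : MvPowerSeries (Fin m) ℤ) (C : ℝ),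
      (∀ k, |((MvPowerSeries.coeff k f : ℤ) : ℝ)| ≤
        C * ∏ i, ((k i + 1 : ℝ) * (ρ i)⁻¹ ^ k i)) →
      ∀ z ∈ polydisc 0 ρ, AbsConv (toComplex f) z := fun f C hf z hz =>
    absConv_of_norm_coeff_le hρ0 (C := C) (fun k => by simpa [toComplex] using hf k) hz
  have hadd : ∀ f₁ f₂ : MvPowerSeries (Fin m) ℤ,
      toComplex (f₁ + f₂) = toComplex f₁ + toComplex f₂ := fun _ _ => map_add _ _ _
  obtain ⟨α, hα, hαne, hαsurj⟩ := exists_enumeration_algebraicPoints hm hρ0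
  have hαρ : ∀ n, α n ∈ polydisc 0 ρ := fun n => (hα n).1.1
  -- The correction is provided for an arbitrary current series `F`, so that the partial sums can be
  -- defined by recursion.
  have hstep : ∀ (n : ℕ) (F : MvPowerSeries (Fin m) ℤ), ∃ q : MvPowerSeries (Fin m) ℤ,
      (∀ k, |((MvPowerSeries.coeff k q : ℤ) : ℝ)| ≤ 1 / 2 / 2 ^ n * k.degree) ∧
      (∀ a ∈ (range n).image α, toFun (toComplex q) a = 0) ∧
      (IsAlgebraic ℚ (toFun (toComplex F) (α n) + toFun (toComplex q) (α n)) ↔ α n ∈ S) ∧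
      toFun (toComplex F) (α n) + toFun (toComplex q) (α n) ≠ toFun (toComplex (g n)) (α n) := by
    intro n F
    refine exists_integral_correction _ (fun a ha => ?_) (fun a ha => ?_) (hα n).2
      (hunit _ (hαρ n)) (fun a ha => ?_) (by positivity) _ _ (fun hreal => ?_) _
    · obtain ⟨j, -, rfl⟩ := mem_image.1 ha
      exact (hα j).2
    · obtain ⟨j, -, rfl⟩ := mem_image.1 ha
      exact hunit _ (hαρ j)
    · obtain ⟨j, hj, rfl⟩ := mem_image.1 ha
      exact hαne j n (mem_range.1 hj).ne
    · rw [← Complex.conj_eq_iff_im, ← toFun_conjPt, conjPt_eq_self hreal]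
  choose corr hcorr_le hcorr_zero hcorr_alg hcorr_ne using hstep
  let f₀ : MvPowerSeries (Fin m) ℤ := fun k => ⌈∏ i, ((k i + 1 : ℝ) * (ρ i)⁻¹ ^ k i)⌉
  have hf₀ : ∀ k, MvPowerSeries.coeff k f₀ = ⌈∏ i, ((k i + 1 : ℝ) * (ρ i)⁻¹ ^ k i)⌉ :=
    fun _ => rfl
  have hf₀_le : ∀ k, |((MvPowerSeries.coeff k f₀ : ℤ) : ℝ)| ≤
      2 * ∏ i, ((k i + 1 : ℝ) * (ρ i)⁻¹ ^ k i) := by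
    intro k
    have h1 := one_le_prod_succ_mul hρ k
    rw [hf₀, abs_of_nonneg (by exact_mod_cast Int.ceil_nonneg (zero_le_one.trans h1))]
    linarith [Int.ceil_lt_add_one (∏ i, ((k i + 1 : ℝ) * (ρ i)⁻¹ ^ k i))]
  let F : ℕ → MvPowerSeries (Fin m) ℤ := fun n => Nat.rec f₀ (fun n G => G + corr n G) n
  have hF : ∀ n, F (n + 1) = F n + corr n (F n) := fun _ => rfl
  set q : ℕ → MvPowerSeries (Fin m) ℤ := fun n => corr n (F n) with hq
  have hq_conv : ∀ n, ∀ z ∈ polydisc 0 ρ, AbsConv (toComplex (q n)) z := fun n =>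
    hconv _ (1 / 2 / 2 ^ n) fun k => (hcorr_le n (F n) k).trans
      (mul_le_mul_of_nonneg_left (degree_le_prod_succ_mul hρ k) (by positivity))
  have hF_conv : ∀ n, ∀ z ∈ polydisc 0 ρ, AbsConv (toComplex (F n)) z ∧
      toFun (toComplex (F n)) z =
        toFun (toComplex f₀) z + ∑ j ∈ range n, toFun (toComplex (q j)) z := by
    intro n z hz
    induction n with
    | zero => exact ⟨hconv _ _ hf₀_le z hz, by simp [F]⟩
    | succ n ih =>
      rw [hF, hadd, toFun_add ih.1 (hq_conv n z hz), ih.2, sum_range_succ, add_assoc]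
      exact ⟨ih.1.add (hq_conv n z hz), rfl⟩
  obtain ⟨s, hs_le, hs⟩ := exists_hasSum_toFun q fun n k => hcorr_le n (F n) k
  have hs_conv : ∀ z ∈ polydisc 0 ρ, AbsConv (toComplex s) z :=
    hconv s 1 fun k => by
      rw [one_mul]
      exact (hs_le k).trans (degree_le_prod_succ_mul hρ k)
  have hf_conv : ∀ z ∈ polydisc 0 ρ, AbsConv (toComplex (f₀ + s)) z := fun z hz => by
    rw [hadd]
    exact (hconv _ _ hf₀_le z hz).add (hs_conv z hz)
  have hval : ∀ n, toFun (toComplex (f₀ + s)) (α n) =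
      toFun (toComplex (F n)) (α n) + toFun (toComplex (q n)) (α n) := by
    intro n
    -- Every correction with index above `n` vanishes at `α n`, so the value there is settled at
    -- stage `n`.
    have hsn : toFun (toComplex s) (α n) =
        ∑ j ∈ range (n + 1), toFun (toComplex (q j)) (α n) := by
      refine (hs (α n) (hunit _ (hαρ n))).unique (hasSum_sum_of_ne_finset_zero fun j hj => ?_)
      have hj' : n < j := by
        rw [mem_range] at hj
        omega
      exact hcorr_zero j (F j) _ (mem_image_of_mem α (mem_range.2 hj'))
    rw [hadd, toFun_add (hconv _ _ hf₀_le _ (hαρ n)) (hs_conv _ (hαρ n)), hsn, sum_range_succ,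
      (hF_conv n _ (hαρ n)).2, add_assoc]
  have halg : ∀ n, IsAlgebraic ℚ (toFun (toComplex (f₀ + s)) (α n)) ↔ α n ∈ S := fun n => by
    rw [hval]
    exact hcorr_alg n (F n)
  have hmem : ∀ z, z ∈ algebraicPoints (polydisc 0 ρ) →
      (IsAlgebraic ℚ (toFun (toComplex (f₀ + s)) z) ↔ z ∈ S) := by
    intro z hz
    by_cases hz0 : z = 0
    · subst hz0
      refine iff_of_true ?_ hzero
      have : toFun (toComplex (f₀ + s)) 0 = ((MvPowerSeries.coeff 0 (f₀ + s) : ℤ) : ℂ) := by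
        rw [toFun, tsum_eq_single 0 fun k hk => ?_]
        · simp [term, toComplex]
        · obtain ⟨i, hi⟩ := Finsupp.ne_iff.1 hk
          rw [term, prod_eq_zero (mem_univ i) (by simpa using hi), mul_zero]
      rw [this]
      exact isAlgebraic_intCast _
    · obtain ⟨n, rfl | rfl⟩ := hαsurj z hz hz0
      · exact halg n
      · rw [toFun_conjPt, isAlgebraic_conj_iff, halg]
        exact ⟨hconj _, fun h => by simpa [conjPt_conjPt] using hconj _ h⟩
  refine ⟨f₀ + s, hasPolyradius_of_le_norm_coeff hρ0 hf_conv fun i N => ?_, hf_conv, ?_, ?_⟩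
  -- With `x = (ρ i)⁻¹ ^ N ≥ 1`, the pure coefficient is at least `(N + 1) x - N ≥ x`. The factor
  -- `kᵢ + 1` in `f₀` is there to outweigh the possible `-N` coming from `s`.
  · have hdeg := hs_le (Finsupp.single i N)
    rw [Finsupp.degree_single, abs_le] at hdeg
    have hceil := Int.le_ceil (∏ j, (((Finsupp.single i N) j + 1 : ℝ) *
      (ρ j)⁻¹ ^ (Finsupp.single i N) j))
    rw [← hf₀, prod_eq_single i (fun j _ hj => by simp [Finsupp.single_eq_of_ne hj]) (by simp),
      Finsupp.single_eq_same] at hceil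
    have hpow : (1 : ℝ) ≤ (ρ i)⁻¹ ^ N := one_le_pow₀ ((one_le_inv₀ (hρ i).1).2 (hρ i).2)
    have hnorm : ‖MvPowerSeries.coeff (Finsupp.single i N) (toComplex (f₀ + s))‖ =
        |((MvPowerSeries.coeff (Finsupp.single i N) f₀ : ℤ) : ℝ) +
          ((MvPowerSeries.coeff (Finsupp.single i N) s : ℤ) : ℝ)| := by
      rw [← Int.cast_add, ← map_add]
      simp [toComplex, -map_add]
    rw [hnorm]
    refine le_trans ?_ (le_abs_self _)
    have hN : (0 : ℝ) ≤ N := by positivity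
    nlinarith
  · ext z
    exact ⟨fun h => (hmem z h.1).1 h.2, fun h => ⟨hS h, (hmem z (hS h)).2 h⟩⟩
  · intro n h
    refine hcorr_ne n (F n) ?_
    rw [← h, hval]

end Exceptional

/-! ### Uncountability -/

theorem theorem1 (m : ℕ) (hm : 1 ≤ m) (ρ : Fin m → ℝ) (hρ : ∀ i, 0 < ρ i ∧ ρ i ≤ 1)
    (S : Set (Fin m → ℂ))
    (hS : S ⊆ Exceptional.algebraicPoints (Exceptional.polydisc 0 ρ))
    (hconj : ∀ z ∈ S, (fun i => (starRingEnd ℂ) (z i)) ∈ S)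
    (hzero : (0 : Fin m → ℂ) ∈ S) :
    ¬ Set.Countable {f : MvPowerSeries (Fin m) ℤ |
      Exceptional.HasPolyradius (Exceptional.toComplex f) ρ ∧
      Exceptional.IsTranscendentalOn (Exceptional.polydisc 0 ρ)
        (Exceptional.toFun (Exceptional.toComplex f)) ∧
      Exceptional.exceptionalSet (Exceptional.polydisc 0 ρ)
        (Exceptional.toFun (Exceptional.toComplex f)) = S} := by
  intro hcount
  -- Adjoining `0` makes the countable set nonempty, hence the range of a sequence.
  obtain ⟨g, hg⟩ := ((hcount.union Exceptional.countable_isAlgebraic_map).union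
    (Set.countable_singleton 0)).exists_eq_range ⟨0, Or.inr rfl⟩
  obtain ⟨f, hrad, hconv, hexc, hne⟩ :=
    Exceptional.exists_exceptionalSet_eq hm hρ hS hconj hzero g
  have hf : f ∉ Set.range g := by
    rintro ⟨n, rfl⟩
    exact hne n rfl
  rw [← hg] at hf
  refine hf (Or.inl (Or.inl ⟨hrad, ?_, hexc⟩))
  exact Exceptional.isTranscendentalOn_of_not_isAlgebraic (fun i => (hρ i).1) hconv
    fun h => hf (Or.inl (Or.inr h))
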